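/- Let $\Bbbk$ be a field of characteristic zero and $\Omega$ a set. An $\Omega$-algebra is a $\Bbbk$-space with bilinear operations $\circ_\omega$, $\omega\in\Omega$; a variety is a class of such algebras defined by polynomial identities. For an algebra $A$, with any family of bilinear operations, let $c_n(A)$ be the $n$th codimension of the variety generated by $A$, i.e. the dimension of the space of multilinear polynomials of degree $n$ in $x_1,\dots,x_n$ modulo the identities of $A$, and let $\mathrm{PIexp}(A)=\lim_{n\to\infty}\sqrt[n]{c_n(A)}$ if this limit exists. Let $\mathrm{Perm}$ be the variety of associative algebras with the identity $(xy-yx)z=0$. For a variety $\mathfrak M$ of $\Omega$-algebras, $\mathrm{di}\text{-}\mathfrak M$ is the variety of algebras with operations $\vdash_\omega,\dashv_\omega$ ($\omega\in\Omega$) defined by all identities that hold on all $P\otimes A$, $P\in\mathrm{Perm}$, $A\in\mathfrak M$, where $$(p\otimes a)\vdash_\omega(q\otimes b)=pq\otimes (a\circ_\omega b),\qquad (p\otimes a)\dashv_\omega(q\otimes b)=qp\otimes (a\circ_\omega b).$$ For $D\in\mathrm{di}\text{-}\mathfrak M$ put $\bar D=D/\mathrm{span}\{a\vdash_\omega b-a\dashv_\omega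 b \mid a,b\in D,\ \omega\in\Omega\}$, and let $\widehat D=\bar D\oplus D$ be the $\Omega$-algebra with the (well-defined) bilinear operations $$\bar a\circ_\omega\bar b=\overline{a\vdash_\omega b},\quad \bar a\circ_\omega b=a\vdash_\omega b,\quad a\circ_\omega\bar b=a\dashv_\omega b,\quad a\circ_\omega b=0\qquad(a,b\in D).$$ **Corollary 4.** Let $\mathfrak M$ be a variety of $\Omega$-algebras such that for every finite-dimensional $A\in\mathfrak M$ the PI-exponent $\mathrm{PIexp}(A)$ exists and is an integer. Then for every finite-dimensional $D\in\mathrm{di}\text{-}\mathfrak M$ the PI-exponents of $D$ and of $\widehat D$ exist, are integers, and satisfy $\mathrm{PIexp}(D)=\mathrm{PIexp}(\widehat D)$. -/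

import Mathlib

open Filter Topology TensorProduct

universe u v w

namespace Dialg

/-- A family of bilinear operations on `A` indexed by `Ω`: the structure of an algebra with
operations `∘_ω`, `ω ∈ Ω`. No identity is imposed. -/
abbrev Ops (k : Type u) [Field k] (Ω : Type v) (A : Type w) [AddCommGroup A] [Module k A] :
    Type (max v w) :=
  Ω → A →ₗ[k] A →ₗ[k] A

/-- Non-associative monomials in the variables `x_0, x_1, …` with operation symbols from `Ω`. -/
inductive Term (Ω : Type v) : Type v
  | var : ℕ → Term Ω
  | op : Ω → Term Ω → Term Ω → Term Ω

/-- The multiset of variables that occur in a monomial. -/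
def Term.vars {Ω : Type v} : Term Ω → Multiset ℕ
  | .var i => {i}
  | .op _ s t => s.vars + t.vars

/-- The value of a monomial in an algebra. -/
def Term.eval {k : Type u} [Field k] {Ω : Type v} {A : Type w} [AddCommGroup A] [Module k A]
    (μ : Ops k Ω A) (a : ℕ → A) : Term Ω → A
  | .var i => a i
  | .op ω s t => μ ω (s.eval μ a) (t.eval μ a)

/-- Polynomials: the underlying space of the absolutely free algebra with operations `Ω` on
countably many generators. -/
abbrev Poly (k : Type u) [Field k] (Ω : Type v) : Type (max u v) := Term Ω →₀ k

section

variable {k : Type u} [Field k] {Ω : Type v} {A : Type w} [AddCommGroup A] [Module k A]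

/-- Evaluation of polynomials at `x_i ↦ a i`. -/
noncomputable def Poly.eval (μ : Ops k Ω A) (a : ℕ → A) : Poly k Ω →ₗ[k] A :=
  Finsupp.linearCombination k (Term.eval μ a)

/-- The polynomial identities of an algebra. -/
noncomputable def identities (μ : Ops k Ω A) : Submodule k (Poly k Ω) :=
  ⨅ a : ℕ → A, LinearMap.ker (Poly.eval μ a)

theorem mem_identities {μ : Ops k Ω A} {f : Poly k Ω} :
    f ∈ identities μ ↔ ∀ a : ℕ → A, Poly.eval μ a f = 0 := by
  simp [identities]

/-- Multilinear polynomials of degree `n` in the variables `x_0, …, x_{n-1}`. -/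
noncomputable def multilinear (k : Type u) [Field k] (Ω : Type v) (n : ℕ) :
    Submodule k (Poly k Ω) :=
  Submodule.span k {f | ∃ t : Term Ω, t.vars = Multiset.range n ∧ f = Finsupp.single t 1}

/-- The `n`-th codimension of the variety generated by an algebra: the dimension of the space of
multilinear polynomials in `x_0, …, x_{n-1}` in the free algebra of that variety, which is the
quotient of the absolutely free algebra by the identities of the given algebra.
(This space is finite-dimensional when the algebra is.) -/
noncomputable def codim (μ : Ops k Ω A) (n : ℕ) : ℕ :=
  Module.finrank k (Submodule.map (identities μ).mkQ (multilinear k Ω n))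

/-- The PI-exponent, the limit of the `n`-th roots of the codimensions, exists and equals `r`. -/
def HasPIExp (μ : Ops k Ω A) (r : ℝ) : Prop :=
  Tendsto (fun n : ℕ => (codim μ n : ℝ) ^ (1 / (n : ℝ))) atTop (𝓝 r)

/-- The PI-exponent exists and is an integer. -/
def HasIntegerPIExp (μ : Ops k Ω A) : Prop :=
  ∃ m : ℤ, HasPIExp μ (m : ℝ)

end

/-- A variety of algebras with operations `Ω`, given by a set of defining identities. -/
structure Variety (k : Type u) [Field k] (Ω : Type v) where
  defining : Set (Poly k Ω)

/-- An algebra belongs to a variety if it satisfies the defining identities. -/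
def Variety.Contains {k : Type u} [Field k] {Ω : Type v} (M : Variety k Ω)
    {A : Type w} [AddCommGroup A] [Module k A] (μ : Ops k Ω A) : Prop :=
  ∀ f ∈ M.defining, f ∈ identities μ

/-- `Perm`: associative algebras with the identity `(x y - y x) z = 0`. -/
structure IsPerm {k : Type u} [Field k] {P : Type w} [AddCommGroup P] [Module k P]
    (mul : P →ₗ[k] P →ₗ[k] P) : Prop where
  assoc : ∀ x y z : P, mul (mul x y) z = mul x (mul y z)
  perm : ∀ x y z : P, mul (mul x y - mul y x) z = 0

/-- The dialgebra `P ⊗ A`, with `⊢_ω` indexed by `Sum.inl ω` and `⊣_ω` by `Sum.inr ω`: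
`(p ⊗ a) ⊢_ω (q ⊗ b) = p q ⊗ (a ∘_ω b)` and `(p ⊗ a) ⊣_ω (q ⊗ b) = q p ⊗ (a ∘_ω b)`. -/
noncomputable def tensorOps {k : Type u} [Field k] {Ω : Type v} {P A : Type w}
    [AddCommGroup P] [Module k P] [AddCommGroup A] [Module k A]
    (mul : P →ₗ[k] P →ₗ[k] P) (μ : Ops k Ω A) : Ops k (Ω ⊕ Ω) (P ⊗[k] A)
  | .inl ω => TensorProduct.map₂ mul (μ ω)
  | .inr ω => TensorProduct.map₂ mul.flip (μ ω)

/-- The variety `di-M`: it is defined by all identities that hold on all dialgebras `P ⊗ A` with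
`P ∈ Perm` and `A ∈ M`. (The universe is large enough for the free algebras of `M` and `Perm`.) -/
def Variety.di {k : Type u} [Field k] {Ω : Type v} (M : Variety k Ω) : Variety k (Ω ⊕ Ω) where
  defining := {g | ∀ (P A : Type (max u v)) [AddCommGroup P] [Module k P] [AddCommGroup A]
    [Module k A] (mul : P →ₗ[k] P →ₗ[k] P) (μ : Ops k Ω A),
    IsPerm mul → M.Contains μ → g ∈ identities (tensorOps mul μ)}

section

variable {k : Type u} [Field k] {Ω : Type v} {D : Type w} [AddCommGroup D] [Module k D]

/-- The dialgebra identities `(x ⊢_ω y - x ⊣_ω y) ⊢_τ z = 0 = x ⊣_τ (y ⊢_ω z - y ⊣_ω z)`. -/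
structure IsZeroDialgebra (δ : Ops k (Ω ⊕ Ω) D) : Prop where
  left : ∀ (ω τ : Ω) (x y z : D),
    δ (.inl τ) (δ (.inl ω) x y - δ (.inr ω) x y) z = 0
  right : ∀ (ω τ : Ω) (x y z : D),
    δ (.inr τ) x (δ (.inl ω) y z - δ (.inr ω) y z) = 0

theorem IsPerm.left_zero {P A : Type w} [AddCommGroup P] [Module k P] [AddCommGroup A]
    [Module k A] {mul : P →ₗ[k] P →ₗ[k] P} (h : IsPerm mul) (μ : Ops k Ω A) :
    IsZeroDialgebra (tensorOps mul μ) := by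
  have key : ∀ p q r : P, mul (mul p q) r = mul (mul q p) r := fun p q r => by
    have := h.perm p q r
    rwa [map_sub, LinearMap.sub_apply, sub_eq_zero] at this
  constructor
  · intro ω τ x y z
    rw [map_sub, LinearMap.sub_apply, sub_eq_zero]
    simp only [tensorOps]
    induction x using TensorProduct.induction_on with
    | zero => simp
    | add x x' hx hx' => simp only [map_add, LinearMap.add_apply, hx, hx']
    | tmul p a =>
      induction y using TensorProduct.induction_on with
      | zero => simp
      | add y y' hy hy' => simp only [map_add, LinearMap.add_apply, hy, hy']
      | tmul q b =>
        induction z using TensorProduct.induction_on with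
        | zero => simp
        | add z z' hz hz' => simp only [map_add, hz, hz']
        | tmul r c => simp [TensorProduct.map₂_apply_tmul, key p q r]
  · intro ω τ x y z
    rw [map_sub, sub_eq_zero]
    simp only [tensorOps]
    induction x using TensorProduct.induction_on with
    | zero => simp
    | add x x' hx hx' => simp only [map_add, LinearMap.add_apply, hx, hx']
    | tmul p a =>
      induction y using TensorProduct.induction_on with
      | zero => simp
      | add y y' hy hy' => simp only [map_add, LinearMap.add_apply, hy, hy']
      | tmul q b =>
        induction z using TensorProduct.induction_on with
        | zero => simp
        | add z z' hz hz' => simp only [map_add, hz, hz']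
        | tmul r c => simp [TensorProduct.map₂_apply_tmul, key q r p]

/-- Every dialgebra in a variety `di-M` satisfies the two identities above. -/
theorem Variety.Contains.isZeroDialgebra {M : Variety k Ω} {δ : Ops k (Ω ⊕ Ω) D}
    (h : M.di.Contains δ) : IsZeroDialgebra δ := by
  constructor
  · intro ω τ x y z
    have := h (Finsupp.single
        (.op (.inl τ) (.op (.inl ω) (.var 0) (.var 1)) (.var 2)) 1 -
        Finsupp.single (.op (.inl τ) (.op (.inr ω) (.var 0) (.var 1)) (.var 2)) 1) (by
      intro P A _ _ _ _ mul μ hP _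
      refine mem_identities.2 fun a => ?_
      have := (hP.left_zero μ).left ω τ (a 0) (a 1) (a 2)
      simpa [Poly.eval, Term.eval] using this)
    have := mem_identities.1 this (fun i => if i = 0 then x else if i = 1 then y else z)
    simpa [Poly.eval, Term.eval] using this
  · intro ω τ x y z
    have := h (Finsupp.single
        (.op (.inr τ) (.var 0) (.op (.inl ω) (.var 1) (.var 2))) 1 -
        Finsupp.single (.op (.inr τ) (.var 0) (.op (.inr ω) (.var 1) (.var 2))) 1) (by
      intro P A _ _ _ _ mul μ hP _
      refine mem_identities.2 fun a => ?_
      have := (hP.left_zero μ).right ω τ (a 0) (a 1) (a 2)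
      simpa [Poly.eval, Term.eval] using this)
    have := mem_identities.1 this (fun i => if i = 0 then x else if i = 1 then y else z)
    simpa [Poly.eval, Term.eval] using this

/-- The span of all `a ⊢_ω b - a ⊣_ω b`. -/
def barKer (δ : Ops k (Ω ⊕ Ω) D) : Submodule k D :=
  Submodule.span k {d | ∃ (ω : Ω) (a b : D), d = δ (.inl ω) a b - δ (.inr ω) a b}

/-- The space `D̄ = D / span (a ⊢_ω b - a ⊣_ω b)`. -/
abbrev Bar (δ : Ops k (Ω ⊕ Ω) D) : Type w := D ⧸ barKer δ

theorem barKer_le_left {δ : Ops k (Ω ⊕ Ω) D} (h : IsZeroDialgebra δ) (ω : Ω) :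
    barKer δ ≤ LinearMap.ker (δ (.inl ω)) := by
  refine Submodule.span_le.2 ?_
  rintro _ ⟨τ, a, b, rfl⟩
  exact LinearMap.ext fun z => h.left τ ω a b z

theorem barKer_le_right {δ : Ops k (Ω ⊕ Ω) D} (h : IsZeroDialgebra δ) (ω : Ω) :
    barKer δ ≤ LinearMap.ker (δ (.inr ω)).flip := by
  refine Submodule.span_le.2 ?_
  rintro _ ⟨τ, a, b, rfl⟩
  exact LinearMap.ext fun z => h.right τ ω z a b

/-- `ā ∘_ω b = a ⊢_ω b`, a map `D̄ × D → D`. -/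
def leftAct (δ : Ops k (Ω ⊕ Ω) D) (h : IsZeroDialgebra δ) (ω : Ω) : Bar δ →ₗ[k] D →ₗ[k] D :=
  (barKer δ).liftQ (δ (.inl ω)) (barKer_le_left h ω)

/-- `a ∘_ω b̄ = a ⊣_ω b`, a map `D × D̄ → D`. -/
def rightAct (δ : Ops k (Ω ⊕ Ω) D) (h : IsZeroDialgebra δ) (ω : Ω) : D →ₗ[k] Bar δ →ₗ[k] D :=
  ((barKer δ).liftQ (δ (.inr ω)).flip (barKer_le_right h ω)).flip

theorem barKer_le_bar {δ : Ops k (Ω ⊕ Ω) D} (h : IsZeroDialgebra δ) (ω : Ω) :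
    barKer δ ≤ LinearMap.ker ((leftAct δ h ω).compr₂ (barKer δ).mkQ).flip := by
  intro b hb
  refine LinearMap.ext fun x => ?_
  obtain ⟨a, rfl⟩ := (barKer δ).mkQ_surjective x
  have h1 : δ (.inr ω) a b = 0 := by
    simpa using congrArg (fun f => f a) (LinearMap.mem_ker.1 (barKer_le_right h ω hb))
  have h2 : δ (.inl ω) a b ∈ barKer δ :=
    Submodule.subset_span ⟨ω, a, b, by simp [h1]⟩
  simpa [leftAct] using h2

/-- The product of `D̄`, induced by `⊢_ω` (equivalently, by `⊣_ω`). -/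
def barMul (δ : Ops k (Ω ⊕ Ω) D) (h : IsZeroDialgebra δ) (ω : Ω) :
    Bar δ →ₗ[k] Bar δ →ₗ[k] Bar δ :=
  ((barKer δ).liftQ ((leftAct δ h ω).compr₂ (barKer δ).mkQ).flip (barKer_le_bar h ω)).flip

/-- The algebra `D̂ = D̄ ⊕ D`, the split null extension of `D̄` by `D`:
`(x + a) ∘_ω (y + b) = x ∘_ω y + (x ∘_ω b + a ∘_ω y)` for `x, y ∈ D̄`, `a, b ∈ D`. -/
def hatOps (δ : Ops k (Ω ⊕ Ω) D) (h : IsZeroDialgebra δ) : Ops k Ω (Bar δ × D) := fun ω =>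
  LinearMap.mk₂ k
    (fun s t => (barMul δ h ω s.1 t.1, leftAct δ h ω s.1 t.2 + rightAct δ h ω s.2 t.1))
    (fun s s' t => by
      ext
      · simp
      · simp only [Prod.fst_add, Prod.snd_add, map_add, LinearMap.add_apply]; abel)
    (fun c s t => by ext <;> simp)
    (fun s t t' => by
      ext
      · simp
      · simp only [Prod.fst_add, Prod.snd_add, map_add]; abel)
    (fun c s t => by ext <;> simp)

end

end Dialg

/-! Two facts suffice: `D̂` lies in `M` (`Variety.Contains.hat`), so that its exponent is an integer
by hypothesis, and the codimensions of `D` and `D̂` bound each other up to a factor `n`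
(`codim_hat_le`, `codim_le`), which is harmless because `n^(1/n) → 1`.

Membership: a `Perm`-algebra `P` embeds as a square-zero odd part in a commutative algebra `C` that
also receives an even image of `P` (`IsPerm.exists_splitNull`). Over an infinite field `C ⊗ A`
satisfies the identities of `A`. Expanding `f(y + z)` with `y` even and `z` odd shows that the
derivative of an identity `f`, linear in `z`, vanishes on `P ⊗ A`, hence on every `D` in `di-M`.
This derivative is the odd part of the values of `f` on `D̂`. The even part lies in `D̄`: for the
component of degree `d`, setting `z = y` in the derivative gives `d` times that value (Euler's
formula), and `d` is invertible in characteristic zero.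

Codimensions: modulo the identities of `D`, a multilinear dialgebra monomial depends only on its
underlying monomial and its central variable, one of `n`. For `n > 0`, a multilinear `f` is an
identity of `D̂` exactly when its `n` markings are identities of `D`. -/

namespace Dialg

/-! ### Monomials, their markings and centers. -/

section Terms

variable {Ω : Type v}

/-- Relabelling the operation symbols and the variables of a monomial. -/
def Term.map {Ω' : Type*} (g : Ω → Ω') (e : ℕ → ℕ) : Term Ω → Term Ω'
  | .var i => .var (e i)
  | .op ω s t => .op (g ω) (s.map g e) (t.map g e)

/-- The dialgebra monomial obtained by letting all operations point at the variable `x_i`. -/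
def Term.mark (i : ℕ) : Term Ω → Term (Ω ⊕ Ω)
  | .var j => .var j
  | .op ω s t => if i ∈ s.vars then .op (.inr ω) (s.mark i) (t.map .inl id)
      else .op (.inl ω) (s.map .inl id) (t.mark i)

/-- The monomial underlying a dialgebra monomial. -/
def Term.forget (S : Term (Ω ⊕ Ω)) : Term Ω := S.map (Sum.elim id id) id

/-- The variable of a dialgebra monomial at which all operations point. -/
def Term.center : Term (Ω ⊕ Ω) → ℕ
  | .var j => j
  | .op (.inl _) _ t => t.center
  | .op (.inr _) s _ => s.center

theorem Term.vars_map {Ω' : Type*} (g : Ω → Ω') (e : ℕ → ℕ) (T : Term Ω) :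
    (T.map g e).vars = T.vars.map e := by
  induction T with
  | var i => simp [Term.map, Term.vars]
  | op ω s t hs ht => simp [Term.map, Term.vars, hs, ht]

theorem Term.map_map {Ω' Ω'' : Type*} (g : Ω → Ω') (g' : Ω' → Ω'') (T : Term Ω) :
    (T.map g id).map g' id = T.map (g' ∘ g) id := by
  induction T with
  | var i => rfl
  | op ω s t hs ht => simp [Term.map, hs, ht]

theorem Term.map_id (T : Term Ω) : T.map id id = T := by
  induction T with
  | var i => rfl
  | op ω s t hs ht => simp [Term.map, hs, ht]

theorem Term.forget_map_inl (T : Term Ω) : (T.map .inl id).forget = T := by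
  rw [Term.forget, Term.map_map, Sum.elim_comp_inl, Term.map_id]

theorem Term.vars_forget (S : Term (Ω ⊕ Ω)) : S.forget.vars = S.vars := by
  rw [Term.forget, Term.vars_map, Multiset.map_id]

theorem Term.vars_mark (i : ℕ) (T : Term Ω) : (T.mark i).vars = T.vars := by
  induction T with
  | var j => rfl
  | op ω s t hs ht =>
    rw [Term.mark]
    split_ifs <;> simp [Term.vars, hs, ht, Term.vars_map]

theorem Term.forget_mark (i : ℕ) (T : Term Ω) : (T.mark i).forget = T := by
  induction T with
  | var j => rfl
  | op ω s t hs ht =>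
    have h1 := s.forget_map_inl
    have h2 := t.forget_map_inl
    rw [Term.forget] at hs ht h1 h2
    rw [Term.mark]
    split_ifs <;> simp [Term.forget, Term.map, hs, ht, h1, h2]

theorem Term.center_mem_vars (S : Term (Ω ⊕ Ω)) : S.center ∈ S.vars := by
  induction S with
  | var j => simp [Term.center, Term.vars]
  | op ω s t hs ht => cases ω <;> simp [Term.center, Term.vars, hs, ht]

theorem Term.card_vars_pos (T : Term Ω) : 0 < T.vars.card := by
  induction T with
  | var i => simp [Term.vars]
  | op ω s t hs ht => simp [Term.vars, hs]

end Terms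

/-! ### Evaluation of monomials and polynomials. -/

section Evaluation

variable {k : Type u} [Field k] {Ω : Type v} {A : Type*} [AddCommGroup A] [Module k A]
  {B : Type*} [AddCommGroup B] [Module k B]

@[simp]
theorem Poly.eval_single (μ : Ops k Ω A) (a : ℕ → A) (T : Term Ω) (c : k) :
    Poly.eval μ a (Finsupp.single T c) = c • T.eval μ a := by
  simp [Poly.eval]

theorem Term.eval_map {Ω' : Type*} (μ : Ops k Ω' A) (a : ℕ → A) (g : Ω → Ω') (e : ℕ → ℕ)
    (T : Term Ω) : (T.map g e).eval μ a = T.eval (fun ω => μ (g ω)) (a ∘ e) := by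
  induction T with
  | var i => rfl
  | op ω s t hs ht => simp [Term.map, Term.eval, hs, ht]

theorem Term.eval_congr (μ : Ops k Ω A) {a b : ℕ → A} {T : Term Ω}
    (h : ∀ i ∈ T.vars, a i = b i) : T.eval μ a = T.eval μ b := by
  induction T with
  | var i => exact h i (by simp [Term.vars])
  | op ω s t hs ht =>
    simp only [Term.vars, Multiset.mem_add] at h
    rw [Term.eval, Term.eval, hs fun i hi => h i (.inl hi), ht fun i hi => h i (.inr hi)]

theorem Term.eval_update_of_notMem (μ : Ops k Ω A) (a : ℕ → A) {i : ℕ} (x : A) {T : Term Ω}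
    (h : i ∉ T.vars) : T.eval μ (Function.update a i x) = T.eval μ a :=
  Term.eval_congr μ fun j hj => Function.update_of_ne (by rintro rfl; exact h hj) _ _

theorem Term.eval_eq_zero (μ : Ops k Ω A) {a : ℕ → A} {i : ℕ} {T : Term Ω} (h : i ∈ T.vars)
    (ha : a i = 0) : T.eval μ a = 0 := by
  induction T with
  | var j =>
    obtain rfl : i = j := by simpa [Term.vars] using h
    exact ha
  | op ω s t hs ht =>
    rcases Multiset.mem_add.1 h with h | h
    · simp [Term.eval, hs h]
    · simp [Term.eval, ht h]

/-- Evaluation of monomials commutes with homomorphisms. -/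
theorem Term.map_eval {μ : Ops k Ω A} {ν : Ops k Ω B} (φ : A →ₗ[k] B)
    (h : ∀ ω x y, φ (μ ω x y) = ν ω (φ x) (φ y)) (a : ℕ → A) (T : Term Ω) :
    φ (T.eval μ a) = T.eval ν (fun i => φ (a i)) := by
  induction T with
  | var i => rfl
  | op ω s t hs ht => simp [Term.eval, h, hs, ht]

/-- Evaluation of polynomials commutes with homomorphisms. -/
theorem Poly.map_eval {μ : Ops k Ω A} {ν : Ops k Ω B} (φ : A →ₗ[k] B)
    (h : ∀ ω x y, φ (μ ω x y) = ν ω (φ x) (φ y)) (a : ℕ → A) (f : Poly k Ω) :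
    φ (Poly.eval μ a f) = Poly.eval ν (fun i => φ (a i)) f := by
  suffices φ ∘ₗ Poly.eval μ a = Poly.eval ν (fun i => φ (a i)) from
    LinearMap.congr_fun this f
  ext T
  simp [Term.map_eval φ h]

/-- Multilinear polynomials can be compared on monomials. -/
theorem eqOn_multilinear {n : ℕ} {φ ψ : Poly k Ω →ₗ[k] B}
    (h : ∀ T : Term Ω, T.vars = Multiset.range n →
      φ (Finsupp.single T 1) = ψ (Finsupp.single T 1))
    {f : Poly k Ω} (hf : f ∈ multilinear k Ω n) : φ f = ψ f := by
  refine LinearMap.eqOn_span (s := {f | ∃ t : Term Ω, t.vars = Multiset.range n ∧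
    f = Finsupp.single t 1}) ?_ hf
  rintro _ ⟨T, hT, rfl⟩
  exact h T hT

end Evaluation

/-! ### Identities under extension of scalars; homogeneous components. -/

section ScalarExtension

variable {k : Type u} [Field k] {Ω : Type v} {A : Type*} [AddCommGroup A] [Module k A]

/-- The extension of scalars `C ⊗ A` of an algebra. -/
noncomputable def extOps (C : Type*) [Ring C] [Algebra k C] (μ : Ops k Ω A) :
    Ops k Ω (C ⊗[k] A) :=
  fun ω => TensorProduct.map₂ (LinearMap.mul k C) (μ ω)

@[simp]
theorem extOps_tmul (C : Type*) [Ring C] [Algebra k C] (μ : Ops k Ω A) (ω : Ω) (c d : C)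
    (a b : A) : extOps C μ ω (c ⊗ₜ a) (d ⊗ₜ b) = (c * d) ⊗ₜ μ ω a b := by
  simp [extOps]

theorem bilin_tensor_ext {P Q R S : Type*} [AddCommGroup P] [Module k P] [AddCommGroup Q]
    [Module k Q] [AddCommGroup R] [Module k R] [AddCommGroup S] [Module k S] {E : Type*}
    [AddCommGroup E] [Module k E] {F G : P ⊗[k] Q →ₗ[k] R ⊗[k] S →ₗ[k] E}
    (h : ∀ p q r s, F (p ⊗ₜ q) (r ⊗ₜ s) = G (p ⊗ₜ q) (r ⊗ₜ s)) (x : P ⊗[k] Q)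
    (y : R ⊗[k] S) : F x y = G x y := by
  suffices F = G by rw [this]
  ext p q r s
  exact h p q r s

theorem rTensor_extOps {C C' : Type*} [Ring C] [Algebra k C] [Ring C'] [Algebra k C']
    (φ : C →ₐ[k] C') (μ : Ops k Ω A) (ω : Ω) (x y : C ⊗[k] A) :
    φ.toLinearMap.rTensor A (extOps C μ ω x y) =
      extOps C' μ ω (φ.toLinearMap.rTensor A x) (φ.toLinearMap.rTensor A y) :=
  bilin_tensor_ext (F := (extOps C μ ω).compr₂ (φ.toLinearMap.rTensor A))
    (G := (extOps C' μ ω).compl₁₂ (φ.toLinearMap.rTensor A) (φ.toLinearMap.rTensor A))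
    (by intros; simp) x y

theorem lid_extOps (μ : Ops k Ω A) (ω : Ω) (x y : k ⊗[k] A) :
    TensorProduct.lid k A (extOps k μ ω x y) =
      μ ω (TensorProduct.lid k A x) (TensorProduct.lid k A y) :=
  bilin_tensor_ext (F := (extOps k μ ω).compr₂ (TensorProduct.lid k A).toLinearMap)
    (G := (μ ω).compl₁₂ (TensorProduct.lid k A).toLinearMap (TensorProduct.lid k A).toLinearMap)
    (by intros; simp [← mul_smul, mul_comm]) x y

/-- In a basis of `A` the coordinates of `x` are polynomials, and over an infinite field a
polynomial vanishing at every point is zero. -/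
theorem eq_zero_of_forall_aeval [Infinite k] {σ : Type*} (x : MvPolynomial σ k ⊗[k] A)
    (h : ∀ s : σ → k, (MvPolynomial.aeval (R := k) s).toLinearMap.rTensor A x = 0) : x = 0 := by
  classical
  have b := Module.Basis.ofVectorSpace k A
  refine (TensorProduct.equivFinsuppOfBasisRight b).injective ?_
  rw [map_zero]
  ext1 i
  refine MvPolynomial.funext fun s => ?_
  have key : ∀ x : MvPolynomial σ k ⊗[k] A,
      MvPolynomial.eval s (TensorProduct.equivFinsuppOfBasisRight b x i) =
        TensorProduct.equivFinsuppOfBasisRight b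
          ((MvPolynomial.aeval (R := k) s).toLinearMap.rTensor A x) i := by
    intro x
    induction x using TensorProduct.induction_on with
    | zero => simp
    | add x y hx hy => simp only [map_add, Finsupp.add_apply, hx, hy]
    | tmul p a => simp [MvPolynomial.aeval_eq_eval, MvPolynomial.smul_eval]
  rw [key, h s]
  simp

/-- Over an infinite field, extension of scalars to a commutative algebra preserves identities. -/
theorem identities_le_extOps [Infinite k] (C : Type*) [CommRing C] [Algebra k C]
    (μ : Ops k Ω A) : identities μ ≤ identities (extOps C μ) := by
  intro f hf
  rw [mem_identities] at hf ⊢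
  -- Polynomial coefficients come first: specializing them to points of `k` returns values of `f` on
  -- `A`.
  have poly : ∀ (a : ℕ → MvPolynomial C k ⊗[k] A),
      Poly.eval (extOps (MvPolynomial C k) μ) a f = 0 := fun a =>
    eq_zero_of_forall_aeval _ fun s => by
      rw [Poly.map_eval _ (rTensor_extOps _ μ)]
      refine (TensorProduct.lid k A).injective ?_
      rw [← LinearEquiv.coe_coe, Poly.map_eval _ (lid_extOps μ), hf, map_zero]
  intro a
  -- Every commutative algebra is a quotient of a polynomial algebra; here one indeterminate is
  -- taken for each element of `C`.
  let φ : MvPolynomial C k →ₐ[k] C := MvPolynomial.aeval id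
  have hφ : Function.Surjective (φ.toLinearMap.rTensor A) :=
    LinearMap.rTensor_surjective A fun c => ⟨MvPolynomial.X c, by simp [φ]⟩
  choose b hb using fun i => hφ (a i)
  have := Poly.map_eval _ (rTensor_extOps φ μ) b f
  rw [poly, map_zero] at this
  simpa only [hb] using this.symm

theorem Term.eval_X_tmul (μ : Ops k Ω A) (a : ℕ → A) (T : Term Ω) :
    T.eval (extOps (Polynomial k) μ) (fun i => (Polynomial.X : Polynomial k) ⊗ₜ[k] a i) =
      ((Polynomial.X : Polynomial k) ^ T.vars.card) ⊗ₜ[k] T.eval μ a := by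
  induction T with
  | var i => simp [Term.eval, Term.vars]
  | op ω s t hs ht => simp [Term.eval, Term.vars, hs, ht, pow_add]

/-- The component of degree `d` of a polynomial. -/
noncomputable def Poly.component (k : Type u) [Field k] (Ω : Type v) (d : ℕ) :
    Poly k Ω →ₗ[k] Poly k Ω :=
  Finsupp.linearCombination k fun T => if T.vars.card = d then Finsupp.single T 1 else 0

/-- Over an infinite field, the homogeneous components of an identity are identities. -/
theorem component_mem_identities [Infinite k] {μ : Ops k Ω A} {f : Poly k Ω}
    (hf : f ∈ identities μ) (d : ℕ) : Poly.component k Ω d f ∈ identities μ := by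
  rw [mem_identities]
  intro a
  have h := mem_identities.1 (identities_le_extOps (Polynomial k) μ hf)
    fun i => (Polynomial.X : Polynomial k) ⊗ₜ[k] a i
  -- Under `x_i ↦ X ⊗ a i` the power of `X` records the degree, so the coefficient at `X^d` is the
  -- value of the component of degree `d`.
  suffices Poly.eval μ a ∘ₗ Poly.component k Ω d =
      ((TensorProduct.lid k A).toLinearMap ∘ₗ (Polynomial.lcoeff k d).rTensor A) ∘ₗ
      Poly.eval (extOps (Polynomial k) μ) (fun i => (Polynomial.X : Polynomial k) ⊗ₜ[k] a i) by
    have := LinearMap.congr_fun this f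
    simpa [h] using this
  ext T
  simp only [LinearMap.comp_apply, Finsupp.lsingle_apply, Poly.eval_single, Term.eval_X_tmul]
  simp only [Poly.component, Finsupp.linearCombination_single, one_smul]
  split_ifs with hd
  · simp [hd]
  · simp [Polynomial.coeff_X_pow, Ne.symm hd]

theorem eq_zero_of_component {B : Type*} [AddCommGroup B] [Module k B] (φ : Poly k Ω →ₗ[k] B)
    (f : Poly k Ω) (h : ∀ d, φ (Poly.component k Ω d f) = 0) : φ f = 0 := by
  have : f = ∑ d ∈ f.support.image (fun T => T.vars.card), Poly.component k Ω d f := by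
    simp only [Poly.component, Finsupp.linearCombination_apply, Finsupp.sum]
    rw [Finset.sum_comm]
    conv_lhs => rw [← Finsupp.sum_single f, Finsupp.sum]
    refine Finset.sum_congr rfl fun T hT => ?_
    rw [Finset.sum_eq_single T.vars.card]
    · simp
    · intro d _ hd
      simp [hd.symm]
    · intro hd
      exact absurd (Finset.mem_image_of_mem _ hT) hd
  rw [this, map_sum]
  exact Finset.sum_eq_zero fun d _ => h d

end ScalarExtension

/-! ### Derivatives of polynomials and split null extensions. -/

section Derivative

variable {k : Type u} [Field k] {Ω : Type v} {D : Type*} [AddCommGroup D] [Module k D]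

/-- The part linear in `z` of the value of a monomial at `y + z`, where each operation points at
the argument that contains the variable evaluated in `z`. -/
def Term.deriv (δ : Ops k (Ω ⊕ Ω) D) (y z : ℕ → D) : Term Ω → D
  | .var i => z i
  | .op ω s t => δ (.inl ω) (s.eval (fun ω => δ (.inl ω)) y) (t.deriv δ y z) +
      δ (.inr ω) (s.deriv δ y z) (t.eval (fun ω => δ (.inl ω)) y)

/-- The linear extension of `Term.deriv` to polynomials. -/
noncomputable def Poly.deriv (δ : Ops k (Ω ⊕ Ω) D) (y z : ℕ → D) : Poly k Ω →ₗ[k] D :=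
  Finsupp.linearCombination k (Term.deriv δ y z)

@[simp]
theorem Poly.deriv_single (δ : Ops k (Ω ⊕ Ω) D) (y z : ℕ → D) (T : Term Ω) (c : k) :
    Poly.deriv δ y z (Finsupp.single T c) = c • T.deriv δ y z := by
  simp [Poly.deriv]

/-- The dialgebra polynomial whose values are given by `Term.deriv`, with `y i` in place of the
variable `x_{2i}` and `z i` in place of `x_{2i+1}`. -/
noncomputable def Term.polar (k : Type u) [Field k] : Term Ω → Poly k (Ω ⊕ Ω)
  | .var i => Finsupp.single (.var (2 * i + 1)) 1
  | .op ω s t => Finsupp.lmapDomain k k (.op (.inl ω) (s.map .inl (2 * ·))) (t.polar k) +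
      Finsupp.lmapDomain k k (fun s' => .op (.inr ω) s' (t.map .inl (2 * ·))) (s.polar k)

/-- The linear extension of `Term.polar` to polynomials. -/
noncomputable def Poly.polar (k : Type u) [Field k] (Ω : Type v) :
    Poly k Ω →ₗ[k] Poly k (Ω ⊕ Ω) :=
  Finsupp.linearCombination k (Term.polar k)

theorem Poly.eval_op_left {A : Type*} [AddCommGroup A] [Module k A] (μ : Ops k Ω A) (a : ℕ → A)
    (ω : Ω) (s : Term Ω) (f : Poly k Ω) :
    Poly.eval μ a (Finsupp.lmapDomain k k (.op ω s) f) = μ ω (s.eval μ a) (Poly.eval μ a f) := by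
  suffices Poly.eval μ a ∘ₗ Finsupp.lmapDomain k k (.op ω s) =
      μ ω (s.eval μ a) ∘ₗ Poly.eval μ a from LinearMap.congr_fun this f
  ext T
  simp [Term.eval]

theorem Poly.eval_op_right {A : Type*} [AddCommGroup A] [Module k A] (μ : Ops k Ω A) (a : ℕ → A)
    (ω : Ω) (t : Term Ω) (f : Poly k Ω) :
    Poly.eval μ a (Finsupp.lmapDomain k k (fun s => .op ω s t) f) =
      μ ω (Poly.eval μ a f) (t.eval μ a) := by
  suffices Poly.eval μ a ∘ₗ Finsupp.lmapDomain k k (fun s => .op ω s t) =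
      (μ ω).flip (t.eval μ a) ∘ₗ Poly.eval μ a from LinearMap.congr_fun this f
  ext T
  simp [Term.eval]

/-- This realizes the derivative by a dialgebra polynomial, so that its vanishing can be transferred
through `di-M`. -/
theorem Term.eval_polar (δ : Ops k (Ω ⊕ Ω) D) (a : ℕ → D) (T : Term Ω) :
    Poly.eval δ a (T.polar k) = T.deriv δ (fun i => a (2 * i)) (fun i => a (2 * i + 1)) := by
  induction T with
  | var i => simp [Term.polar, Term.deriv, Term.eval]
  | op ω s t hs ht =>
    rw [Term.polar, map_add, Poly.eval_op_left, Poly.eval_op_right, hs, ht, Term.eval_map,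
      Term.eval_map]
    rfl

theorem Poly.eval_polar (δ : Ops k (Ω ⊕ Ω) D) (a : ℕ → D) (f : Poly k Ω) :
    Poly.eval δ a (Poly.polar k Ω f) =
      Poly.deriv δ (fun i => a (2 * i)) (fun i => a (2 * i + 1)) f := by
  suffices Poly.eval δ a ∘ₗ Poly.polar k Ω =
      Poly.deriv δ (fun i => a (2 * i)) (fun i => a (2 * i + 1)) from LinearMap.congr_fun this f
  ext T
  simp [Poly.polar, Term.eval_polar]

/-- A split null extension: the maps `α`, `β` embed the dialgebra `D` as an even and an odd part
into an algebra `B`. -/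
structure IsSplitNull {B : Type*} [AddCommGroup B] [Module k B] (δ : Ops k (Ω ⊕ Ω) D)
    (ν : Ops k Ω B) (α β : D →ₗ[k] B) : Prop where
  even_even : ∀ ω a b, ν ω (α a) (α b) = α (δ (.inl ω) a b)
  even_odd : ∀ ω a b, ν ω (α a) (β b) = β (δ (.inl ω) a b)
  odd_even : ∀ ω a b, ν ω (β a) (α b) = β (δ (.inr ω) a b)
  odd_odd : ∀ ω a b, ν ω (β a) (β b) = 0

variable {B : Type*} [AddCommGroup B] [Module k B] {δ : Ops k (Ω ⊕ Ω) D} {ν : Ops k Ω B}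
  {α β : D →ₗ[k] B}

/-- Products of two odd elements vanish, so the expansion stops at the terms linear in `z`. -/
theorem IsSplitNull.term_eval (h : IsSplitNull δ ν α β) (y z : ℕ → D) (T : Term Ω) :
    T.eval ν (fun i => α (y i) + β (z i)) =
      α (T.eval (fun ω => δ (.inl ω)) y) + β (T.deriv δ y z) := by
  induction T with
  | var i => rfl
  | op ω s t hs ht =>
    simp only [Term.eval, Term.deriv, hs, ht, map_add, LinearMap.add_apply, h.even_even,
      h.even_odd, h.odd_even, h.odd_odd]
    abel

theorem IsSplitNull.eval (h : IsSplitNull δ ν α β) (y z : ℕ → D) (f : Poly k Ω) :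
    Poly.eval ν (fun i => α (y i) + β (z i)) f =
      α (Poly.eval (fun ω => δ (.inl ω)) y f) + β (Poly.deriv δ y z f) := by
  suffices Poly.eval ν (fun i => α (y i) + β (z i)) =
      α ∘ₗ Poly.eval (fun ω => δ (.inl ω)) y + β ∘ₗ Poly.deriv δ y z from
    LinearMap.congr_fun this f
  ext T
  simp [h.term_eval]

end Derivative

/-! ### Commutative split null extensions of `Perm`-algebras. -/

section Perm

variable {k : Type u} [Field k] {P : Type w} [AddCommGroup P] [Module k P]
  {mul : P →ₗ[k] P →ₗ[k] P}

theorem IsPerm.left_comm (h : IsPerm mul) (x y z : P) :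
    mul (mul x y) z = mul (mul y x) z := by
  have := h.perm x y z
  rwa [map_sub, LinearMap.sub_apply, sub_eq_zero] at this

/-- The linear operators that commute with all left multiplications. -/
def permCentralizer (mul : P →ₗ[k] P →ₗ[k] P) : Submodule k (Module.End k P) :=
  Subalgebra.toSubmodule (Subalgebra.centralizer k (Set.range mul))

theorem mem_permCentralizer {T : Module.End k P} :
    T ∈ permCentralizer mul ↔ ∀ p q : P, mul p (T q) = T (mul p q) := by
  rw [permCentralizer, Subalgebra.mem_toSubmodule, Subalgebra.mem_centralizer_iff]
  exact ⟨fun h p q => LinearMap.congr_fun (h (mul p) ⟨p, rfl⟩) q,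
    by rintro h _ ⟨p, rfl⟩; exact LinearMap.ext (h p)⟩

/-- Left multiplications preserve the operators that commute with left multiplications. -/
theorem IsPerm.mul_mem_permCentralizer (h : IsPerm mul) (p : P) (T : permCentralizer mul) :
    mul p * T.1 ∈ permCentralizer mul :=
  -- The computation is `q(p T(r)) = (qp) T(r) = (pq) T(r) = p(q T(r)) = p T(qr)`.
  mem_permCentralizer.2 fun q r => by
    rw [Module.End.mul_apply, Module.End.mul_apply, ← mem_permCentralizer.1 T.2, ← h.assoc,
      ← h.assoc, h.left_comm]

/-- The space on which the split null extension of a `Perm`-algebra acts. -/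
def PermSplit (mul : P →ₗ[k] P →ₗ[k] P) : Type w := permCentralizer mul × P

instance : AddCommGroup (PermSplit mul) := inferInstanceAs (AddCommGroup (permCentralizer mul × P))

instance : Module k (PermSplit mul) := inferInstanceAs (Module k (permCentralizer mul × P))

/-- The action of an even element on the split null extension. -/
def IsPerm.even (h : IsPerm mul) : P →ₗ[k] Module.End k (PermSplit mul) :=
  (LinearMap.mk₂ k (fun p v => (⟨mul p * v.1.1, h.mul_mem_permCentralizer p v.1⟩, mul p v.2))
    (fun p q v => by simp [add_mul])
    (fun c p v => by simp)
    (fun p v w => by simp [mul_add])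
    (fun c p v => by simp) :
    P →ₗ[k] permCentralizer mul × P →ₗ[k] permCentralizer mul × P)

/-- The action of an odd element on the split null extension. -/
def permOdd (mul : P →ₗ[k] P →ₗ[k] P) : P →ₗ[k] Module.End k (PermSplit mul) :=
  (LinearMap.mk₂ k (fun r v => (0, v.1.1 r))
    (fun p q v => by simp)
    (fun c p v => by simp)
    (fun p v w => by simp)
    (fun c p v => by simp) :
    P →ₗ[k] permCentralizer mul × P →ₗ[k] permCentralizer mul × P)

theorem IsPerm.even_mul_even (h : IsPerm mul) (p q : P) :
    h.even p * h.even q = h.even (mul p q) := by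
  refine LinearMap.ext fun v => Prod.ext (Subtype.ext (LinearMap.ext fun r => ?_)) ?_
  · exact (h.assoc p q (v.1.1 r)).symm
  · exact (h.assoc p q v.2).symm

/-- Products in `P` commute only when a further factor stands to their right; as operators they
always have one. -/
theorem IsPerm.even_comm (h : IsPerm mul) (p q : P) :
    h.even (mul p q) = h.even (mul q p) := by
  refine LinearMap.ext fun v => Prod.ext (Subtype.ext (LinearMap.ext fun r => ?_)) ?_
  · exact h.left_comm p q (v.1.1 r)
  · exact h.left_comm p q v.2

/-- This is why the first component is restricted to operators commuting with left multiplications: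
`p T(q) = T(pq)`. -/
theorem IsPerm.even_mul_odd (h : IsPerm mul) (p q : P) :
    h.even p * permOdd mul q = permOdd mul (mul p q) := by
  refine LinearMap.ext fun v => Prod.ext (Subtype.ext (LinearMap.ext fun r => ?_)) ?_
  · exact map_zero (mul p)
  · exact mem_permCentralizer.1 v.1.2 p q

theorem IsPerm.odd_mul_even (h : IsPerm mul) (p q : P) :
    permOdd mul p * h.even q = permOdd mul (mul q p) :=
  LinearMap.ext fun v => Prod.ext rfl (mem_permCentralizer.1 v.1.2 q p)

theorem permOdd_mul_odd (p q : P) : permOdd mul p * permOdd mul q = 0 :=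
  LinearMap.ext fun _ => Prod.ext rfl rfl

/-- The commutative algebra generated by the even and odd operators. -/
def IsPerm.splitNull (h : IsPerm mul) : Subalgebra k (Module.End k (PermSplit mul)) :=
  Algebra.adjoin k (Set.range h.even ∪ Set.range (permOdd mul))

theorem IsPerm.isMulCommutative_splitNull (h : IsPerm mul) : IsMulCommutative h.splitNull := by
  refine Algebra.isMulCommutative_adjoin k ?_
  rintro _ (⟨p, rfl⟩ | ⟨p, rfl⟩) _ (⟨q, rfl⟩ | ⟨q, rfl⟩)
  · rw [h.even_mul_even, h.even_mul_even, h.even_comm]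
  · rw [h.even_mul_odd, h.odd_mul_even]
  · rw [h.even_mul_odd, h.odd_mul_even]
  · rw [permOdd_mul_odd, permOdd_mul_odd]

/-- Even elements of the split null extension. -/
def IsPerm.evenIncl (h : IsPerm mul) : P →ₗ[k] h.splitNull :=
  h.even.codRestrict h.splitNull.toSubmodule
    fun p => Algebra.subset_adjoin (.inl ⟨p, rfl⟩)

/-- Odd elements of the split null extension. -/
def IsPerm.oddIncl (h : IsPerm mul) : P →ₗ[k] h.splitNull :=
  (permOdd mul).codRestrict h.splitNull.toSubmodule
    fun p => Algebra.subset_adjoin (.inr ⟨p, rfl⟩)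

/-- A left inverse of `IsPerm.oddIncl`. -/
def IsPerm.oddPart (h : IsPerm mul) : h.splitNull →ₗ[k] P where
  -- Applying the odd operator of `r` to `(1, 0)` gives `(0, r)`, which recovers `r`.
  toFun c := (c.1 (⟨1, mem_permCentralizer.2 fun _ _ => rfl⟩, 0)).2
  map_add' _ _ := rfl
  map_smul' _ _ := rfl

theorem IsPerm.evenIncl_mul_evenIncl (h : IsPerm mul) (p q : P) :
    h.evenIncl p * h.evenIncl q = h.evenIncl (mul p q) := Subtype.ext (h.even_mul_even p q)

theorem IsPerm.evenIncl_mul_oddIncl (h : IsPerm mul) (p q : P) :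
    h.evenIncl p * h.oddIncl q = h.oddIncl (mul p q) := Subtype.ext (h.even_mul_odd p q)

theorem IsPerm.oddIncl_mul_oddIncl (h : IsPerm mul) (p q : P) :
    h.oddIncl p * h.oddIncl q = 0 := Subtype.ext (permOdd_mul_odd p q)

/-- Every `Perm`-algebra has a commutative split null extension. -/
theorem IsPerm.exists_splitNull (h : IsPerm mul) :
    ∃ (C : Type w) (_ : CommRing C) (_ : Algebra k C) (α β : P →ₗ[k] C) (π : C →ₗ[k] P),
      (∀ p q, α p * α q = α (mul p q)) ∧ (∀ p q, α p * β q = β (mul p q)) ∧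
      (∀ p q, β p * β q = 0) ∧ π ∘ₗ β = .id := by
  have := h.isMulCommutative_splitNull
  exact ⟨h.splitNull, { (inferInstance : Ring h.splitNull) with mul_comm := mul_comm' },
    inferInstanceAs (Algebra k h.splitNull), h.evenIncl, h.oddIncl, h.oddPart,
    h.evenIncl_mul_evenIncl, h.evenIncl_mul_oddIncl, h.oddIncl_mul_oddIncl, rfl⟩

variable {Ω : Type v} {A : Type w} [AddCommGroup A] [Module k A]

/-- Commutativity of `C` turns `β p * α q` into `β (q p)`, the order of factors that `⊣` uses. -/
theorem isSplitNull_ext {C : Type*} [CommRing C] [Algebra k C] {α β : P →ₗ[k] C}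
    (h1 : ∀ p q, α p * α q = α (mul p q)) (h2 : ∀ p q, α p * β q = β (mul p q))
    (h3 : ∀ p q, β p * β q = 0) (μ : Ops k Ω A) :
    IsSplitNull (tensorOps mul μ) (extOps C μ) (α.rTensor A) (β.rTensor A) where
  even_even ω := bilin_tensor_ext
    (F := (extOps C μ ω).compl₁₂ (α.rTensor A) (α.rTensor A))
    (G := (tensorOps mul μ (.inl ω)).compr₂ (α.rTensor A))
    (by intros; simp [tensorOps, h1])
  even_odd ω := bilin_tensor_ext
    (F := (extOps C μ ω).compl₁₂ (α.rTensor A) (β.rTensor A))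
    (G := (tensorOps mul μ (.inl ω)).compr₂ (β.rTensor A))
    (by intros; simp [tensorOps, h2])
  odd_even ω := bilin_tensor_ext
    (F := (extOps C μ ω).compl₁₂ (β.rTensor A) (α.rTensor A))
    (G := (tensorOps mul μ (.inr ω)).compr₂ (β.rTensor A))
    (by intros; simp [tensorOps, mul_comm (β _), h2])
  odd_odd ω := bilin_tensor_ext
    (F := (extOps C μ ω).compl₁₂ (β.rTensor A) (β.rTensor A)) (G := 0)
    (by intros; simp [h3])

/-- The derivative of an identity of `A` is an identity of every `P ⊗ A`. -/
theorem IsPerm.polar_mem_identities [Infinite k] (h : IsPerm mul) {μ : Ops k Ω A} {f : Poly k Ω}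
    (hf : f ∈ identities μ) : Poly.polar k Ω f ∈ identities (tensorOps mul μ) := by
  obtain ⟨C, _, _, α, β, π, h1, h2, h3, h4⟩ := h.exists_splitNull
  have hs := isSplitNull_ext h1 h2 h3 μ
  refine mem_identities.2 fun a => ?_
  rw [Poly.eval_polar]
  set y := fun i => a (2 * i)
  set z := fun i => a (2 * i + 1)
  have hz : ∀ w, Poly.eval (extOps C μ) w f = 0 :=
    mem_identities.1 (identities_le_extOps C μ hf)
  -- Since `α` is multiplicative, the even part is itself a value of `f` on `C ⊗ A` and vanishes;
  -- only the derivative remains, and `π` strips `β` from it.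
  have hy := Poly.map_eval (μ := fun ω => tensorOps mul μ (.inl ω)) _
    (fun ω a b => (hs.even_even ω a b).symm) y f
  have hyz := hs.eval y z f
  rw [hz, hy, hz, zero_add] at hyz
  have hπ := congrArg (π.rTensor A) hyz
  rw [map_zero, ← LinearMap.comp_apply, ← LinearMap.rTensor_comp, h4, LinearMap.rTensor_id] at hπ
  exact hπ.symm

/-- The hypothesis allows any consequence of the defining identities, because the result is applied
to homogeneous components of these. -/
theorem Variety.polar_mem_di [Infinite k] (M : Variety k Ω) {f : Poly k Ω}
    (hf : ∀ (A : Type (max u v)) [AddCommGroup A] [Module k A] (μ : Ops k Ω A),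
      M.Contains μ → f ∈ identities μ) : Poly.polar k Ω f ∈ M.di.defining :=
  fun _ A _ _ _ _ _ μ hP hM => hP.polar_mem_identities (hf A μ hM)

end Perm

/-! ### The algebra `D̂` belongs to `M`. -/

section Hat

variable {k : Type u} [Field k] {Ω : Type v} {D : Type w} [AddCommGroup D] [Module k D]
  {δ : Ops k (Ω ⊕ Ω) D}

theorem mkQ_inl (h : IsZeroDialgebra δ) (ω : Ω) (a b : D) :
    (barKer δ).mkQ (δ (.inl ω) a b) = barMul δ h ω ((barKer δ).mkQ a) ((barKer δ).mkQ b) := rfl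

theorem mkQ_inr (h : IsZeroDialgebra δ) (ω : Ω) (a b : D) :
    (barKer δ).mkQ (δ (.inr ω) a b) = barMul δ h ω ((barKer δ).mkQ a) ((barKer δ).mkQ b) := by
  rw [← mkQ_inl, eq_comm, ← sub_eq_zero, ← map_sub, Submodule.mkQ_apply,
    Submodule.Quotient.mk_eq_zero]
  exact Submodule.subset_span ⟨ω, a, b, rfl⟩

theorem isSplitNull_hat (h : IsZeroDialgebra δ) :
    IsSplitNull δ (hatOps δ h) (LinearMap.inl k _ D ∘ₗ (barKer δ).mkQ)
      (LinearMap.inr k (Bar δ) D) where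
  even_even ω a b := by ext <;> simp [hatOps, leftAct, barMul]
  even_odd ω a b := by ext <;> simp [hatOps, leftAct]
  odd_even ω a b := by ext <;> simp [hatOps, rightAct]
  odd_odd ω a b := by ext <;> simp [hatOps]

/-- Euler's formula: both operations induce the same product on `D̄`, so each variable contributes
one copy of the value. -/
theorem mkQ_deriv_self (h : IsZeroDialgebra δ) (y : ℕ → D) (T : Term Ω) :
    (barKer δ).mkQ (T.deriv δ y y) =
      (T.vars.card : k) • (barKer δ).mkQ (T.eval (fun ω => δ (.inl ω)) y) := by
  induction T with
  | var i => simp [Term.deriv, Term.vars, Term.eval]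
  | op ω s t hs ht =>
    simp only [Term.deriv, Term.eval, map_add, mkQ_inl h, mkQ_inr h, hs, ht, Term.vars,
      Multiset.card_add, Nat.cast_add, map_smul, LinearMap.smul_apply, add_smul]
    exact add_comm _ _

theorem mkQ_deriv_component (h : IsZeroDialgebra δ) (y : ℕ → D) (f : Poly k Ω) (d : ℕ) :
    (barKer δ).mkQ (Poly.deriv δ y y (Poly.component k Ω d f)) =
      (d : k) • (barKer δ).mkQ
        (Poly.eval (fun ω => δ (.inl ω)) y (Poly.component k Ω d f)) := by
  suffices (barKer δ).mkQ ∘ₗ Poly.deriv δ y y ∘ₗ Poly.component k Ω d =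
      (d : k) • (barKer δ).mkQ ∘ₗ Poly.eval (fun ω => δ (.inl ω)) y ∘ₗ Poly.component k Ω d from
    LinearMap.congr_fun this f
  ext T
  by_cases hd : T.vars.card = d
  · have := mkQ_deriv_self h y T
    simp only [hd] at this
    simpa [Poly.component, hd] using this
  · simp [Poly.component, hd]

theorem component_zero (f : Poly k Ω) : Poly.component k Ω 0 f = 0 := by
  suffices Poly.component k Ω 0 = 0 from LinearMap.congr_fun this f
  refine Finsupp.lhom_ext fun T c => ?_
  simp only [Poly.component, Finsupp.linearCombination_single, if_neg T.card_vars_pos.ne',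
    smul_zero, LinearMap.zero_apply]

/-- If `D` lies in `di-M`, then `D̂` lies in `M`. -/
theorem Variety.Contains.hat [CharZero k] {M : Variety k Ω} (hD : M.di.Contains δ) :
    M.Contains (hatOps δ hD.isZeroDialgebra) := by
  intro f hf
  have h := hD.isZeroDialgebra
  have deriv (d : ℕ) (y z : ℕ → D) : Poly.deriv δ y z (Poly.component k Ω d f) = 0 := by
    have h1 := hD _ (M.polar_mem_di (f := Poly.component k Ω d f) fun A _ _ μ hA =>
      component_mem_identities (hA f hf) d)
    -- The values `y` and `z` are interleaved at even and odd indices, as `Term.polar` expects.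
    have h2 := mem_identities.1 h1 fun i => if i % 2 = 0 then y (i / 2) else z (i / 2)
    rw [Poly.eval_polar] at h2
    have e1 : ∀ i : ℕ, (2 * i + 1) % 2 = 1 := fun i => by omega
    have e2 : ∀ i : ℕ, (2 * i + 1) / 2 = i := fun i => by omega
    simpa [e1, e2] using h2
  refine mem_identities.2 fun a => eq_zero_of_component _ f fun d => ?_
  choose y hy using fun i => (barKer δ).mkQ_surjective (a i).1
  have ha : a = fun i => (LinearMap.inl k _ D ∘ₗ (barKer δ).mkQ) (y i) +
      LinearMap.inr k (Bar δ) D (a i).2 := by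
    funext i
    ext <;> simp [← hy]
  rw [ha, (isSplitNull_hat h).eval, deriv, map_zero, add_zero]
  rcases Nat.eq_zero_or_pos d with rfl | hd
  · simp [component_zero]
  -- The derivative at `z = y` is zero, so `d` times the value in `D̄` is zero, and `d ≠ 0` in `k`.
  · have h1 := mkQ_deriv_component h y f d
    rw [deriv, map_zero, eq_comm, smul_eq_zero] at h1
    have h2 := h1.resolve_left (Nat.cast_ne_zero.2 hd.ne')
    rw [LinearMap.comp_apply, h2, map_zero]

end Hat

/-! ### Markings of multilinear polynomials: identities of `D` against those of `D̂`. -/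

section Marking

variable {k : Type u} [Field k] {Ω : Type v} {D : Type w} [AddCommGroup D] [Module k D]
  {δ : Ops k (Ω ⊕ Ω) D}

theorem mkQ_eval (h : IsZeroDialgebra δ) (y : ℕ → D) (S : Term (Ω ⊕ Ω)) :
    (barKer δ).mkQ (S.eval δ y) =
      S.forget.eval (barMul δ h) (fun i => (barKer δ).mkQ (y i)) := by
  induction S with
  | var i => rfl
  | op ω s t hs ht =>
    rcases ω with ω | ω
    · rw [Term.eval, mkQ_inl h, hs, ht]; rfl
    · rw [Term.eval, mkQ_inr h, hs, ht]; rfl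

theorem IsZeroDialgebra.inl_congr (h : IsZeroDialgebra δ) (ω : Ω) {a a' : D}
    (ha : (barKer δ).mkQ a = (barKer δ).mkQ a') (b : D) :
    δ (.inl ω) a b = δ (.inl ω) a' b :=
  congrArg (fun x => leftAct δ h ω x b) ha

theorem IsZeroDialgebra.inr_congr (h : IsZeroDialgebra δ) (ω : Ω) (a : D) {b b' : D}
    (hb : (barKer δ).mkQ b = (barKer δ).mkQ b') : δ (.inr ω) a b = δ (.inr ω) a b' :=
  congrArg (fun x => rightAct δ h ω a x) hb

/-- In a zero-dialgebra, a monomial linear in each variable is determined by the underlying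
monomial and the central variable. -/
theorem Term.eval_mark_center (h : IsZeroDialgebra δ) (y : ℕ → D) {S : Term (Ω ⊕ Ω)}
    (hS : S.vars.Nodup) : (S.forget.mark S.center).eval δ y = S.eval δ y := by
  induction S with
  | var i => rfl
  | op ω s t hs ht =>
    rw [Term.vars, Multiset.nodup_add] at hS
    obtain ⟨hs', ht', hd⟩ := hS
    -- Off the path to the center a factor matters only modulo `barKer δ`, so the operations inside
    -- it can all be replaced by `⊢`.
    have bar (S : Term (Ω ⊕ Ω)) : (barKer δ).mkQ ((S.forget.map .inl id).eval δ y) =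
        (barKer δ).mkQ (S.eval δ y) := by
      rw [mkQ_eval h, mkQ_eval h, Term.forget_map_inl]
    rcases ω with ω | ω
    · have hc : t.center ∉ s.forget.vars := by
        rw [Term.vars_forget]
        exact fun hc => Multiset.disjoint_left.1 hd hc t.center_mem_vars
      change (Term.mark t.center (.op ω s.forget t.forget)).eval δ y = _
      rw [Term.mark, if_neg hc, Term.eval, Term.eval, ht ht', h.inl_congr ω (bar s)]
    · have hc : s.center ∈ s.forget.vars := by
        rw [Term.vars_forget]
        exact s.center_mem_vars
      change (Term.mark s.center (.op ω s.forget t.forget)).eval δ y = _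
      rw [Term.mark, if_pos hc, Term.eval, Term.eval, hs hs', h.inr_congr ω _ (bar t)]

/-- The derivative of a monomial linear in each variable is the sum of its markings. -/
theorem Term.deriv_eq_sum_mark (δ : Ops k (Ω ⊕ Ω) D) (y z : ℕ → D) {T : Term Ω}
    (hT : T.vars.Nodup) : T.deriv δ y z =
      (T.vars.map fun i => (T.mark i).eval δ (Function.update y i (z i))).sum := by
  induction T with
  | var i => simp [Term.deriv, Term.vars, Term.mark, Term.eval]
  | op ω s t hs ht =>
    rw [Term.vars, Multiset.nodup_add] at hT
    obtain ⟨hs', ht', hd⟩ := hT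
    rw [Term.vars, Multiset.map_add, Multiset.sum_add, Term.deriv, add_comm, hs hs', ht ht']
    congr 1
    · rw [← LinearMap.flip_apply (δ (.inr ω)), map_multiset_sum, Multiset.map_map]
      refine congrArg _ (Multiset.map_congr rfl fun i hi => ?_)
      have hi' : i ∉ (t.map (Sum.inl : Ω → Ω ⊕ Ω) id).vars := by
        rw [Term.vars_map, Multiset.map_id]
        exact Multiset.disjoint_left.1 hd hi
      simp only [Function.comp_apply, LinearMap.flip_apply]
      rw [Term.mark, if_pos hi, Term.eval, Term.eval_update_of_notMem _ _ _ hi', Term.eval_map]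
      rfl
    · rw [map_multiset_sum, Multiset.map_map]
      refine congrArg _ (Multiset.map_congr rfl fun i hi => ?_)
      have hi' : i ∉ s.vars := fun h => Multiset.disjoint_left.1 hd h hi
      have hi'' : i ∉ (s.map (Sum.inl : Ω → Ω ⊕ Ω) id).vars := by
        rwa [Term.vars_map, Multiset.map_id]
      simp only [Function.comp_apply]
      rw [Term.mark, if_neg hi', Term.eval, Term.eval_update_of_notMem _ _ _ hi'', Term.eval_map]
      rfl

/-- The linear extension of `Term.mark` to polynomials. -/
noncomputable def Poly.mark (k : Type u) [Field k] (Ω : Type v) (i : ℕ) :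
    Poly k Ω →ₗ[k] Poly k (Ω ⊕ Ω) :=
  Finsupp.lmapDomain k k (Term.mark i)

@[simp]
theorem Poly.mark_single (i : ℕ) (T : Term Ω) (c : k) :
    Poly.mark k Ω i (Finsupp.single T c) = Finsupp.single (T.mark i) c := by
  simp [Poly.mark]

theorem Poly.mark_mem_multilinear (i : ℕ) {n : ℕ} {f : Poly k Ω} (hf : f ∈ multilinear k Ω n) :
    Poly.mark k Ω i f ∈ multilinear k (Ω ⊕ Ω) n := by
  refine (Submodule.span_le (p := (multilinear k (Ω ⊕ Ω) n).comap (Poly.mark k Ω i))).2 ?_ hf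
  rintro _ ⟨T, hT, rfl⟩
  exact Submodule.subset_span ⟨T.mark i, by rw [Term.vars_mark, hT], by simp⟩

/-- Marking chooses between `⊢` and `⊣`, which coincide in `D̄`. -/
theorem mkQ_eval_mark (h : IsZeroDialgebra δ) (y : ℕ → D) (i : ℕ) (f : Poly k Ω) :
    (barKer δ).mkQ (Poly.eval δ y (Poly.mark k Ω i f)) =
      (barKer δ).mkQ (Poly.eval (fun ω => δ (.inl ω)) y f) := by
  suffices (barKer δ).mkQ ∘ₗ Poly.eval δ y ∘ₗ Poly.mark k Ω i =
      (barKer δ).mkQ ∘ₗ Poly.eval (fun ω => δ (.inl ω)) y from LinearMap.congr_fun this f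
  ext T
  have := Term.eval_map δ y .inl id T
  rw [Function.comp_id] at this
  simp only [LinearMap.comp_apply, Finsupp.lsingle_apply, Poly.mark_single, Poly.eval_single,
    one_smul]
  rw [← this, mkQ_eval h, mkQ_eval h, Term.forget_mark, Term.forget_map_inl]

theorem Poly.deriv_eq_sum_mark (δ : Ops k (Ω ⊕ Ω) D) (y z : ℕ → D) {n : ℕ} {f : Poly k Ω}
    (hf : f ∈ multilinear k Ω n) : Poly.deriv δ y z f =
      ∑ i ∈ Finset.range n, Poly.eval δ (Function.update y i (z i)) (Poly.mark k Ω i f) := by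
  have := eqOn_multilinear (φ := Poly.deriv δ y z)
    (ψ := ∑ i ∈ Finset.range n, Poly.eval δ (Function.update y i (z i)) ∘ₗ Poly.mark k Ω i)
    (fun T hT => ?_) hf
  · simpa using this
  · rw [Poly.deriv_single, one_smul, Term.deriv_eq_sum_mark, hT]
    · simp only [LinearMap.sum_apply, LinearMap.comp_apply, Poly.mark_single,
        Poly.eval_single, one_smul]
      rfl
    · rw [hT]; exact Multiset.nodup_range n

theorem Poly.eval_mark_eq_zero (δ : Ops k (Ω ⊕ Ω) D) {y : ℕ → D} {n i j : ℕ} (hj : j < n)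
    (hy : y j = 0) {f : Poly k Ω} (hf : f ∈ multilinear k Ω n) :
    Poly.eval δ y (Poly.mark k Ω i f) = 0 := by
  refine eqOn_multilinear (φ := Poly.eval δ y ∘ₗ Poly.mark k Ω i) (ψ := 0) (fun T hT => ?_) hf
  have : j ∈ (T.mark i).vars := by
    rw [Term.vars_mark, hT]
    exact Multiset.mem_range.2 hj
  simp [Term.eval_eq_zero δ this hy]

/-- Taking the odd part zero except at `x_i`, where it is `y i`, isolates one marking: the `j`-th
marking with `j ≠ i` is evaluated with `x_j = 0`. -/
theorem mark_mem_identities (h : IsZeroDialgebra δ) {n i : ℕ} (hi : i < n) {f : Poly k Ω}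
    (hf : f ∈ multilinear k Ω n) (hfi : f ∈ identities (hatOps δ h)) :
    Poly.mark k Ω i f ∈ identities δ := by
  refine mem_identities.2 fun y => ?_
  have h1 := mem_identities.1 hfi fun j =>
    (LinearMap.inl k _ D ∘ₗ (barKer δ).mkQ) (y j) +
      LinearMap.inr k (Bar δ) D ((Pi.single i (y i) : ℕ → D) j)
  rw [(isSplitNull_hat h).eval, Poly.deriv_eq_sum_mark δ _ _ hf,
    Finset.sum_eq_single_of_mem i (Finset.mem_range.2 hi)] at h1
  · simpa using congrArg Prod.snd h1
  · intro j hj hji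
    refine Poly.eval_mark_eq_zero δ (Finset.mem_range.1 hj) ?_ hf
    simp [hji]

/-- The odd part of a value is a sum of values of markings; the even part is the image of any single
marking, so `n > 0` supplies marking `0`. -/
theorem mem_identities_hat (h : IsZeroDialgebra δ) {n : ℕ} (hn : 0 < n) {f : Poly k Ω}
    (hf : f ∈ multilinear k Ω n) (hfi : ∀ i < n, Poly.mark k Ω i f ∈ identities δ) :
    f ∈ identities (hatOps δ h) := by
  refine mem_identities.2 fun a => ?_
  choose y hy using fun i => (barKer δ).mkQ_surjective (a i).1
  have ha : a = fun i => (LinearMap.inl k _ D ∘ₗ (barKer δ).mkQ) (y i) +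
      LinearMap.inr k (Bar δ) D (a i).2 := by
    funext i
    ext <;> simp [← hy]
  rw [ha, (isSplitNull_hat h).eval, Poly.deriv_eq_sum_mark δ _ _ hf, LinearMap.comp_apply,
    ← mkQ_eval_mark h y 0, mem_identities.1 (hfi 0 hn),
    Finset.sum_eq_zero fun i hi => mem_identities.1 (hfi i (Finset.mem_range.1 hi)) _]
  simp

end Marking

/-! ### Comparison of codimensions. -/

section Codimension

/-- A linear map on a subspace is dominated by another one with smaller kernel. -/
theorem exists_factor {k V W W' : Type*} [Field k] [AddCommGroup V] [Module k V]
    [AddCommGroup W] [Module k W] [AddCommGroup W'] [Module k W'] (S : Submodule k V)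
    (g : V →ₗ[k] W) (h : V →ₗ[k] W') (hgh : ∀ x ∈ S, g x = 0 → h x = 0) :
    ∃ φ : W →ₗ[k] W', ∀ x ∈ S, φ (g x) = h x := by
  have hker : LinearMap.ker (g.domRestrict S) ≤ LinearMap.ker (h.domRestrict S) :=
    fun x hx => hgh x x.2 hx
  obtain ⟨φ, hφ⟩ := LinearMap.exists_extend
    ((LinearMap.ker (g.domRestrict S)).liftQ (h.domRestrict S) hker ∘ₗ
      (g.domRestrict S).quotKerEquivRange.symm.toLinearMap)
  refine ⟨φ, fun x hx => ?_⟩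
  have := LinearMap.congr_fun hφ ⟨g x, ⟨x, hx⟩, rfl⟩
  have e : (g.domRestrict S).quotKerEquivRange.symm ⟨g x, ⟨x, hx⟩, rfl⟩ =
      Submodule.Quotient.mk ⟨x, hx⟩ := by
    rw [LinearEquiv.symm_apply_eq]
    rfl
  simpa [e] using this

variable {k : Type u} [Field k] {Ω : Type v} {A : Type*} [AddCommGroup A] [Module k A]

/-- Extension of a finite sequence by zero. -/
def extendZero {n : ℕ} (x : Fin n → A) (i : ℕ) : A := if h : i < n then x ⟨i, h⟩ else 0

theorem extendZero_update {n : ℕ} [DecidableEq (Fin n)] (x : Fin n → A) (i : Fin n) (c : A) :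
    extendZero (Function.update x i c) = Function.update (extendZero x) (i : ℕ) c := by
  funext j
  by_cases hj : j < n
  · by_cases hij : j = i
    · subst hij; simp [extendZero]
    · have : (⟨j, hj⟩ : Fin n) ≠ i := fun h => hij (congrArg Fin.val h)
      simp [extendZero, hj, hij, this]
  · have : j ≠ i := fun h => hj (h ▸ i.2)
    simp [extendZero, hj, this]

theorem Term.eval_update_add (μ : Ops k Ω A) (a : ℕ → A) {i : ℕ} (x y : A) {T : Term Ω}
    (hT : T.vars.Nodup) (hi : i ∈ T.vars) :
    T.eval μ (Function.update a i (x + y)) =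
      T.eval μ (Function.update a i x) + T.eval μ (Function.update a i y) := by
  induction T with
  | var j =>
    obtain rfl : i = j := by simpa [Term.vars] using hi
    simp [Term.eval]
  | op ω s t hs ht =>
    rw [Term.vars, Multiset.nodup_add] at hT
    obtain ⟨hs', ht', hd⟩ := hT
    rcases Multiset.mem_add.1 hi with hi | hi
    · have := Multiset.disjoint_left.1 hd hi
      simp [Term.eval, hs hs' hi, Term.eval_update_of_notMem μ a _ this]
    · have : i ∉ s.vars := fun h => Multiset.disjoint_left.1 hd h hi
      simp [Term.eval, ht ht' hi, Term.eval_update_of_notMem μ a _ this]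

theorem Term.eval_update_smul (μ : Ops k Ω A) (a : ℕ → A) {i : ℕ} (c : k) (x : A) {T : Term Ω}
    (hT : T.vars.Nodup) (hi : i ∈ T.vars) :
    T.eval μ (Function.update a i (c • x)) = c • T.eval μ (Function.update a i x) := by
  induction T with
  | var j =>
    obtain rfl : i = j := by simpa [Term.vars] using hi
    simp [Term.eval]
  | op ω s t hs ht =>
    rw [Term.vars, Multiset.nodup_add] at hT
    obtain ⟨hs', ht', hd⟩ := hT
    rcases Multiset.mem_add.1 hi with hi | hi
    · have := Multiset.disjoint_left.1 hd hi
      simp [Term.eval, hs hs' hi, Term.eval_update_of_notMem μ a _ this]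
    · have : i ∉ s.vars := fun h => Multiset.disjoint_left.1 hd h hi
      simp [Term.eval, ht ht' hi, Term.eval_update_of_notMem μ a _ this]

/-- The multilinear map given by a multilinear monomial. -/
def Term.multilinearMap (μ : Ops k Ω A) {n : ℕ} (T : Term Ω) (hT : T.vars = Multiset.range n) :
    MultilinearMap k (fun _ : Fin n => A) A where
  toFun x := T.eval μ (extendZero x)
  map_update_add' x i a b := by
    simp only [extendZero_update]
    exact T.eval_update_add μ _ a b (hT ▸ Multiset.nodup_range n)
      (hT ▸ Multiset.mem_range.2 i.2)
  map_update_smul' x i c a := by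
    simp only [extendZero_update]
    exact T.eval_update_smul μ _ c a (hT ▸ Multiset.nodup_range n)
      (hT ▸ Multiset.mem_range.2 i.2)

/-- The functions of `n` arguments given by polynomials. -/
noncomputable def Poly.toFun (μ : Ops k Ω A) (n : ℕ) : Poly k Ω →ₗ[k] (Fin n → A) → A :=
  LinearMap.pi fun x => Poly.eval μ (extendZero x)

/-- These functions are multilinear maps `A^n → A`, which form a finite-dimensional space. -/
theorem finite_map_toFun [FiniteDimensional k A] (μ : Ops k Ω A) (n : ℕ) :
    FiniteDimensional k (Submodule.map (Poly.toFun μ n) (multilinear k Ω n)) := by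
  let c : MultilinearMap k (fun _ : Fin n => A) A →ₗ[k] (Fin n → A) → A :=
    { toFun := fun F => F, map_add' := fun _ _ => rfl, map_smul' := fun _ _ => rfl }
  refine Submodule.finiteDimensional_of_le (S₂ := LinearMap.range c) ?_
  rw [Submodule.map_le_iff_le_comap]
  refine Submodule.span_le.2 ?_
  rintro _ ⟨T, hT, rfl⟩
  exact ⟨T.multilinearMap μ hT, by funext x; simp [Poly.toFun, c, Term.multilinearMap]⟩

/-- The space whose dimension is the codimension is finite-dimensional. -/
theorem finite_map_mkQ [FiniteDimensional k A] (μ : Ops k Ω A) (n : ℕ) :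
    FiniteDimensional k (Submodule.map (identities μ).mkQ (multilinear k Ω n)) := by
  -- Only the first `n` variables occur, so a multilinear polynomial inducing the zero function of
  -- `n` arguments is an identity.
  obtain ⟨φ, hφ⟩ := exists_factor (multilinear k Ω n) (Poly.toFun μ n) (identities μ).mkQ
    (fun f hf h0 => by
      rw [Submodule.mkQ_apply, Submodule.Quotient.mk_eq_zero, mem_identities]
      intro a
      have h1 : Poly.eval μ (extendZero fun i : Fin n => a i) f = 0 :=
        congrFun h0 fun i : Fin n => a i
      rw [← h1]
      refine eqOn_multilinear (fun T hT => ?_) hf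
      rw [Poly.eval_single, Poly.eval_single, Term.eval_congr μ fun i hi => ?_]
      rw [hT, Multiset.mem_range] at hi
      simp [extendZero, hi])
  have := finite_map_toFun μ n
  refine Submodule.finiteDimensional_of_le
    (S₂ := Submodule.map φ (Submodule.map (Poly.toFun μ n) (multilinear k Ω n))) ?_
  rintro _ ⟨f, hf, rfl⟩
  exact ⟨_, ⟨f, hf, rfl⟩, hφ f hf⟩

variable {D : Type w} [AddCommGroup D] [Module k D] [FiniteDimensional k D]
  {δ : Ops k (Ω ⊕ Ω) D}

/-- By `mem_identities_hat`, the `n` markings together determine `f` modulo the identities of `D̂`.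
-/
theorem codim_hat_le (h : IsZeroDialgebra δ) {n : ℕ} (hn : 0 < n) :
    codim (hatOps δ h) n ≤ n * codim δ n := by
  -- Finite dimension is essential here: `finrank` is `0` on an infinite-dimensional space.
  have := finite_map_mkQ δ n
  let S := Submodule.map (identities δ).mkQ (multilinear k (Ω ⊕ Ω) n)
  obtain ⟨φ, hφ⟩ := exists_factor (multilinear k Ω n)
    (LinearMap.pi fun i : Fin n => (identities δ).mkQ ∘ₗ Poly.mark k Ω i)
    (identities (hatOps δ h)).mkQ (fun f hf h0 => by
      rw [Submodule.mkQ_apply, Submodule.Quotient.mk_eq_zero]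
      refine mem_identities_hat h hn hf fun i hi => ?_
      rw [← Submodule.Quotient.mk_eq_zero]
      exact congrFun h0 ⟨i, hi⟩)
  let ψ : (Fin n → S) →ₗ[k] (Fin n → Poly k (Ω ⊕ Ω) ⧸ identities δ) :=
    LinearMap.pi fun i => S.subtype ∘ₗ LinearMap.proj i
  have hle : Submodule.map (identities (hatOps δ h)).mkQ (multilinear k Ω n) ≤
      LinearMap.range (φ ∘ₗ ψ) := by
    rintro _ ⟨f, hf, rfl⟩
    exact ⟨fun i => ⟨_, Poly.mark k Ω i f, Poly.mark_mem_multilinear i hf, rfl⟩, hφ f hf⟩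
  calc codim (hatOps δ h) n ≤ Module.finrank k (LinearMap.range (φ ∘ₗ ψ)) :=
        Submodule.finrank_mono hle
    _ ≤ Module.finrank k (Fin n → S) := LinearMap.finrank_range_le _
    _ = n * codim δ n := by simp [Module.finrank_pi_fintype, S, codim]

/-- By `mark_mem_identities` each marking descends to the quotients, and by `Term.eval_mark_center`
the `n` markings together reach every multilinear monomial. -/
theorem codim_le (h : IsZeroDialgebra δ) (n : ℕ) :
    codim δ n ≤ n * codim (hatOps δ h) n := by
  have := finite_map_mkQ (hatOps δ h) n
  let S := Submodule.map (identities (hatOps δ h)).mkQ (multilinear k Ω n)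
  choose φ hφ using fun i : Fin n => exists_factor (multilinear k Ω n)
    (identities (hatOps δ h)).mkQ ((identities δ).mkQ ∘ₗ Poly.mark k Ω i) (fun f hf h0 => by
      rw [Submodule.mkQ_apply, Submodule.Quotient.mk_eq_zero] at h0
      rw [LinearMap.comp_apply, Submodule.mkQ_apply, Submodule.Quotient.mk_eq_zero]
      exact mark_mem_identities h i.2 hf h0)
  let ψ : (Fin n → S) →ₗ[k] Poly k (Ω ⊕ Ω) ⧸ identities δ :=
    ∑ i, φ i ∘ₗ S.subtype ∘ₗ LinearMap.proj i
  have hle : Submodule.map (identities δ).mkQ (multilinear k (Ω ⊕ Ω) n) ≤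
      LinearMap.range ψ := by
    rw [Submodule.map_le_iff_le_comap]
    refine Submodule.span_le.2 ?_
    rintro _ ⟨T, hT, rfl⟩
    have hc : T.center < n := Multiset.mem_range.1 (hT ▸ T.center_mem_vars)
    have hf : Finsupp.single T.forget (1 : k) ∈ multilinear k Ω n :=
      Submodule.subset_span ⟨T.forget, by rw [T.vars_forget, hT], rfl⟩
    -- The preimage of a monomial is its underlying monomial, placed in the coordinate of its
    -- center.
    refine ⟨Pi.single ⟨T.center, hc⟩ ⟨_, _, hf, rfl⟩, ?_⟩
    have hψ : ∀ (i : Fin n) (s : S), ψ (Pi.single i s) = φ i s := fun i s => by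
      simp only [ψ, LinearMap.sum_apply, LinearMap.comp_apply, LinearMap.proj_apply]
      rw [Finset.sum_eq_single i]
      · simp
      · intro j _ hj
        simp [hj]
      · simp
    rw [hψ]
    simp only [hφ _ _ hf]
    rw [LinearMap.comp_apply, ← sub_eq_zero, ← map_sub, Submodule.mkQ_apply,
      Submodule.Quotient.mk_eq_zero, mem_identities]
    intro a
    simp [Term.eval_mark_center h a (hT ▸ Multiset.nodup_range n : T.vars.Nodup)]
  calc codim δ n ≤ Module.finrank k (LinearMap.range ψ) := Submodule.finrank_mono hle
    _ ≤ Module.finrank k (Fin n → S) := LinearMap.finrank_range_le _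
    _ = n * codim (hatOps δ h) n := by simp [Module.finrank_pi_fintype, S, codim]

end Codimension

/-- Sequences that differ by at most a linear factor have the same exponential growth. -/
theorem tendsto_root_of_le_mul {b c : ℕ → ℕ} {r : ℝ} (h1 : ∀ n, 0 < n → b n ≤ n * c n)
    (h2 : ∀ n, 0 < n → c n ≤ n * b n)
    (hb : Tendsto (fun n : ℕ => (b n : ℝ) ^ (1 / (n : ℝ))) atTop (𝓝 r)) :
    Tendsto (fun n : ℕ => (c n : ℝ) ^ (1 / (n : ℝ))) atTop (𝓝 r) := by
  have hn : Tendsto (fun n : ℕ => (n : ℝ) ^ (1 / (n : ℝ))) atTop (𝓝 1) :=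
    tendsto_rpow_div.comp tendsto_natCast_atTop_atTop
  have root {x y n : ℕ} (h : x ≤ n * y) :
      (x : ℝ) ^ (1 / (n : ℝ)) ≤ (n : ℝ) ^ (1 / (n : ℝ)) * (y : ℝ) ^ (1 / (n : ℝ)) := by
    rw [← Real.mul_rpow (by positivity) (by positivity)]
    exact Real.rpow_le_rpow (by positivity) (by exact_mod_cast h) (by positivity)
  -- The `n`-th root of `c n` is squeezed between that of `b n` divided by `n^(1/n)` and that of `b
  -- n` multiplied by `n^(1/n)`.
  have lower := hb.div hn one_ne_zero
  have upper := hn.mul hb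
  rw [div_one] at lower
  rw [one_mul] at upper
  refine tendsto_of_tendsto_of_tendsto_of_le_of_le' lower upper ?_ ?_
  · filter_upwards [eventually_gt_atTop 0] with n hn
    have : (0 : ℝ) < (n : ℝ) ^ (1 / (n : ℝ)) := by positivity
    exact (div_le_iff₀' this).2 (root (h1 n hn))
  · filter_upwards [eventually_gt_atTop 0] with n hn
    exact root (h2 n hn)

end Dialg

theorem corollary4 {k : Type u} [Field k] [CharZero k] {Ω : Type v} (M : Dialg.Variety k Ω)
    (hM : ∀ (A : Type w) [AddCommGroup A] [Module k A] [FiniteDimensional k A]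
      (μ : Dialg.Ops k Ω A), M.Contains μ → Dialg.HasIntegerPIExp μ)
    (D : Type w) [AddCommGroup D] [Module k D] [FiniteDimensional k D]
    (δ : Dialg.Ops k (Ω ⊕ Ω) D) (hD : M.di.Contains δ) :
    ∃ m : ℤ, Dialg.HasPIExp δ (m : ℝ) ∧
      Dialg.HasPIExp (Dialg.hatOps δ hD.isZeroDialgebra) (m : ℝ) := by
  obtain ⟨m, hm⟩ := hM _ _ hD.hat
  exact ⟨m, Dialg.tendsto_root_of_le_mul (fun _ hn => Dialg.codim_hat_le hD.isZeroDialgebra hn)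
    (fun n _ => Dialg.codim_le hD.isZeroDialgebra n) hm, hm⟩
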